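/- **General univalent snail lemma.** Let $K\subset\mathbb{C}$ be nonempty, compact and connected, let $U\subset\mathbb{C}$ be an open set containing $K$, and let $f\colon U\to\mathbb{C}$ be univalent (holomorphic and injective) with $f(K)=K$. Let $\gamma\colon(-\infty,1]\to U\setminus K$ be a curve (a continuous map) such that $f(\gamma(t))=\gamma(t+1)$ for all $t\le 0$ and $\lim_{t\to-\infty}\operatorname{dist}(\gamma(t),K)=0$. Then $\gamma$ lands at a repelling or parabolic fixed point of $f$; that is, there is a point $z_0\in U$ with $f(z_0)=z_0$ and $\lim_{t\to-\infty}\gamma(t)=z_0$ such that either $|f'(z_0)|>1$ (repelling), or $f'(z_0)$ is a root of unity and no iterate $f^m$, $m\ge 1$, is the identity on a neighborhood of $z_0$ (parabolic). -/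

import Mathlib

open Set Filter Topology

/-- `f` is univalent on `U`: holomorphic and injective on the open set `U`. The values of `f`
outside `U` are irrelevant. -/
structure IsUnivalentOn (f : ℂ → ℂ) (U : Set ℂ) : Prop where
  isOpen : IsOpen U
  differentiableOn : DifferentiableOn ℂ f U
  injOn : InjOn f U

/-- `z` is a repelling fixed point of `f`: its multiplier `f'(z)` has modulus `> 1`. -/
def IsRepellingFixedPt (f : ℂ → ℂ) (z : ℂ) : Prop :=
  Function.IsFixedPt f z ∧ 1 < ‖deriv f z‖

/-- `z` is a parabolic fixed point of `f`: its multiplier `f'(z)` is a root of unity, but no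
iterate `f^m`, `m ≥ 1`, is the identity near `z`. -/
def IsParabolicFixedPt (f : ℂ → ℂ) (z : ℂ) : Prop :=
  Function.IsFixedPt f z ∧ (∃ n : ℕ, 0 < n ∧ deriv f z ^ n = 1) ∧
    ∀ m : ℕ, 0 < m → ¬ (f^[m] =ᶠ[𝓝 z] id)

/-- The snail lemma property of `(f, K)`, where `f` is defined on the neighbourhood `U` of `K`:
every curve `γ : (-∞, 1] → U \ K` with `f (γ t) = γ (t + 1)` for all `t ≤ 0` and
`dist (γ t, K) → 0` as `t → -∞` lands at a repelling or parabolic fixed point of `f`, that is,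
`γ t` converges to such a point as `t → -∞`. The curve is a function on `ℝ` of which only the
restriction to `(-∞, 1]` is used. -/
def HasSnailLemmaProperty (f : ℂ → ℂ) (U K : Set ℂ) : Prop :=
  ∀ γ : ℝ → ℂ, ContinuousOn γ (Iic 1) → MapsTo γ (Iic 1) (U \ K) →
    (∀ t ≤ 0, f (γ t) = γ (t + 1)) →
    Tendsto (fun t => Metric.infDist (γ t) K) atBot (𝓝 0) →
    ∃ z₀ ∈ U, (IsRepellingFixedPt f z₀ ∨ IsParabolicFixedPt f z₀) ∧ Tendsto γ atBot (𝓝 z₀)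

/-! Let `g` be the inverse of `f` near `K`; it pushes `γ` backwards in time, towards `K`. The engine
is a length-area argument. Around a point of `γ`, a small disk does not meet its own forward images
under `g`, so injectivity makes these images pairwise disjoint. They lie in a set of finite area,
hence some small circle has images of small total energy (`exists_circle_energy_le`). By the maximum
principle the images of the enclosed disk are small too; since the circle meets `γ`, whose orbits
tend to `K`, they never leave the domain, and their diameters tend to zero
(`exists_isContractingBall`).

Chaining such disks along `γ` gives `γ (t - 1) - γ t → 0`, so every limit point of `γ` is a fixed
point in `K`. Fixed points near a limit point are isolated because `g` moves every point of `γ`, so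
`γ` converges to some `p`.

An attracting `p` for `f` is impossible, since backward orbits would move away from it. If the
multiplier `μ` of `g` has modulus one, some power `μ ^ k` is close to one, so `g^[k]` moves points
near `p` very little on the scale of `log (z - p)`. As `g^[k]` moves the image of a contracting disk
off itself, that image contains no large disk in this coordinate. Bloch's theorem then bounds the
derivative of the logarithm, so the ratios `(γ (s - n) - p) / (γ (t - n) - p)` tend to one. Taking
`s = t - 1` identifies the limit as `μ`, whence `μ = 1` and `p` is parabolic. -/

/-! ### Holomorphic inverse of a univalent map. -/

/-- The inverse is continuous by the open mapping theorem and differentiable away from the critical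
values. These are isolated, hence removable, so `f' ≠ 0` need not be proved. -/
theorem IsUnivalentOn.exists_inverse {f : ℂ → ℂ} {U : Set ℂ} (hf : IsUnivalentOn f U) :
    ∃ g : ℂ → ℂ, IsOpen (f '' U) ∧ DifferentiableOn ℂ g (f '' U) ∧ ∀ z ∈ U, g (f z) = z := by
  classical
  have hU := hf.isOpen
  have han : AnalyticOnNhd ℂ f U := hf.differentiableOn.analyticOnNhd hU
  -- the image of a neighbourhood is a neighbourhood
  have hmap : ∀ z ∈ U, 𝓝 (f z) ≤ map f (𝓝 z) := by
    intro z hz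
    rcases (han z hz).eventually_constant_or_nhds_le_map_nhds with h | h
    · exfalso
      obtain ⟨w, hw, hwz⟩ := ((h.and (hU.mem_nhds hz)).filter_mono
        (nhdsWithin_le_nhds (s := {z}ᶜ))|>.and self_mem_nhdsWithin).exists
      exact hwz (hf.injOn hw.2 hz hw.1)
    · exact h
  have hopen : IsOpen (f '' U) := by
    rw [isOpen_iff_mem_nhds]
    rintro _ ⟨z, hz, rfl⟩
    exact hmap z hz (image_mem_map (hU.mem_nhds hz))
  set g := Function.invFunOn f U with hg
  have hgf : ∀ z ∈ U, g (f z) = z := fun z hz ↦ hf.injOn.leftInvOn_invFunOn hz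
  have hcont : ∀ z ∈ U, ContinuousAt g (f z) := by
    intro z hz
    rw [ContinuousAt, hgf z hz]
    refine (tendsto_map'_iff.2 ?_).mono_left (hmap z hz)
    refine Tendsto.congr' ?_ tendsto_id
    filter_upwards [hU.mem_nhds hz] with w hw
    simp [hgf w hw]
  have hdiff : ∀ z ∈ U, deriv f z ≠ 0 → DifferentiableAt ℂ g (f z) := by
    intro z hz h
    have h1 : HasDerivAt f (deriv f z) (g (f z)) := by
      rw [hgf z hz]; exact (han z hz).differentiableAt.hasDerivAt
    refine (h1.of_local_left_inverse (hcont z hz) h ?_).differentiableAt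
    filter_upwards [hopen.mem_nhds (mem_image_of_mem f hz)] with y hy
    obtain ⟨w, hw, rfl⟩ := hy
    rw [hgf w hw]
  refine ⟨g, hopen, ?_, hgf⟩
  rintro _ ⟨z, hz, rfl⟩
  refine DifferentiableAt.differentiableWithinAt ?_
  -- zeros of the derivative are isolated
  have hiso : ∀ᶠ w in 𝓝[≠] z, deriv f w ≠ 0 := by
    rcases (han z hz).deriv.eventually_eq_zero_or_eventually_ne_zero with h | h
    · exfalso
      obtain ⟨r, hr, hb⟩ := Metric.eventually_nhds_iff_ball.1 (h.and (hU.mem_nhds hz))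
      have hconst : ∀ w ∈ Metric.ball z r, f w = f z := by
        intro w hw
        refine (convex_ball z r).is_const_of_fderivWithin_eq_zero (𝕜 := ℂ) (f := f)
          (fun x hx ↦ (han x (hb x hx).2).differentiableAt.differentiableWithinAt) ?_ hw
          (Metric.mem_ball_self hr)
        intro x hx
        rw [fderivWithin_of_isOpen Metric.isOpen_ball hx]
        ext
        simpa using (hb x hx).1
      have h2 : z + (r / 2 : ℝ) ∈ Metric.ball z r := by
        simp [abs_of_pos hr]; linarith
      have := hf.injOn (hb _ h2).2 hz (hconst _ h2)
      simp at this
      exact hr.ne' this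
    · exact h
  have hpunct : ∀ᶠ y in 𝓝[≠] (f z), DifferentiableAt ℂ g y := by
    rw [eventually_nhdsWithin_iff] at hiso ⊢
    have := hmap z hz (image_mem_map (hiso.and (hU.mem_nhds hz)))
    filter_upwards [this]
    rintro _ ⟨w, ⟨hw, hwU⟩, rfl⟩ hne
    exact hdiff w hwU (hw fun h ↦ hne (by simp at h; simp [h]))
  obtain ⟨s, hs, hso⟩ := (mem_nhdsWithin_iff_exists_mem_nhds_inter.1 hpunct)
  have h3 : DifferentiableOn ℂ g (s \ {f z}) := fun y hy ↦
    (hso ⟨hy.1, hy.2⟩ : DifferentiableAt ℂ g y).differentiableWithinAt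
  exact ((Complex.differentiableOn_compl_singleton_and_continuousAt_iff hs).1
    ⟨h3, hcont z hz⟩).differentiableAt hs

/-! ### Length-area estimates. -/

open MeasureTheory in
/-- The area of a univalent image. -/
theorem lintegral_enorm_deriv_sq_eq_volume_image {F : ℂ → ℂ} {D : Set ℂ} (hD : IsOpen D)
    (hF : DifferentiableOn ℂ F D) (hinj : InjOn F D) :
    ∫⁻ z in D, ‖deriv F z‖ₑ ^ 2 = volume (F '' D) := by
  have hder : ∀ z ∈ D, HasFDerivWithinAt F
      (((ContinuousLinearMap.toSpanSingleton ℂ (deriv F z)).restrictScalars ℝ : ℂ →L[ℝ] ℂ)) D z :=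
    fun z hz ↦ (((hF.differentiableAt (hD.mem_nhds hz)).hasDerivAt.hasFDerivAt).restrictScalars
      ℝ).hasFDerivWithinAt
  rw [← lintegral_abs_det_fderiv_eq_addHaar_image volume hD.measurableSet hder hinj]
  refine lintegral_congr fun z ↦ ?_
  have hdet : ((ContinuousLinearMap.toSpanSingleton ℂ (deriv F z)).restrictScalars ℝ :
      ℂ →L[ℝ] ℂ).det = ‖deriv F z‖ ^ 2 := by
    have : ((ContinuousLinearMap.toSpanSingleton ℂ (deriv F z)).restrictScalars ℝ :
      ℂ →L[ℝ] ℂ).det = Algebra.norm ℝ (deriv F z) := by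
      rw [ContinuousLinearMap.det, Algebra.norm_apply]
      congr 1
      ext : 1
      simp [mul_comm]
    rw [this, Algebra.norm_complex_apply, Complex.normSq_eq_norm_sq]
  rw [hdet, abs_of_nonneg (by positivity), ENNReal.ofReal_pow (norm_nonneg _), ofReal_norm]

open MeasureTheory Real in
/-- Courant-Lebesgue: if univalent maps `F j` have disjoint images of finite total area, then there
are arbitrarily small circles along which the `F j` have small total energy. -/
theorem exists_circle_energy_le {F : ℕ → ℂ → ℂ} {D : ℕ → Set ℂ} (hD : ∀ j, IsOpen (D j))
    (hF : ∀ j, DifferentiableOn ℂ (F j) (D j)) (hinj : ∀ j, InjOn (F j) (D j))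
    (hdisj : Pairwise fun i j ↦ Disjoint (F i '' D i) (F j '' D j)) {S : Set ℂ}
    (hS : volume S < ⊤) (hFS : ∀ j, F j '' D j ⊆ S) (c : ℂ) {ρ ε : ℝ} (hρ : 0 < ρ) (hε : 0 < ε) :
    ∃ r ∈ Ioo 0 ρ, ENNReal.ofReal (r ^ 2) * ∑' j, ∫⁻ θ in Ioo (-π) π,
      (D j).indicator (fun z ↦ ‖deriv (F j) z‖ₑ ^ 2) (circleMap c r θ) ≤ ENNReal.ofReal ε := by
  by_contra! hcon
  set h : ℂ → ENNReal := fun z ↦ ∑' j, (D j).indicator (fun z ↦ ‖deriv (F j) z‖ₑ ^ 2) z with hh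
  have hmj : ∀ j, Measurable ((D j).indicator (fun z ↦ ‖deriv (F j) z‖ₑ ^ 2)) := fun j ↦
    ((measurable_deriv (F j)).enorm.pow_const 2).indicator (hD j).measurableSet
  have hm : Measurable h := Measurable.tsum hmj
  have hfin : ∫⁻ z, h z < ⊤ := by
    rw [hh, lintegral_tsum fun j ↦ (hmj j).aemeasurable]
    have h1 : ∀ j, ∫⁻ z, (D j).indicator (fun z ↦ ‖deriv (F j) z‖ₑ ^ 2) z
        = volume (F j '' D j) := fun j ↦ by
      rw [lintegral_indicator (hD j).measurableSet,
        lintegral_enorm_deriv_sq_eq_volume_image (hD j) (hF j) (hinj j)]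
    have h2 : ∀ j, MeasurableSet (F j '' D j) := fun j ↦
      (hD j).measurableSet.image_of_continuousOn_injOn (hF j).continuousOn (hinj j)
    simp_rw [h1]
    rw [← measure_iUnion hdisj h2]
    exact (measure_mono (iUnion_subset hFS)).trans_lt hS
  have hpolar : ∫⁻ r in Ioi (0 : ℝ), ∫⁻ θ in Ioo (-π) π,
      ENNReal.ofReal r * h (circleMap c r θ) < ⊤ := by
    have h1 := Complex.lintegral_comp_polarCoord_symm (fun z ↦ h (c + z))
    rw [lintegral_add_left_eq_self] at h1
    have h3 : ∀ p : ℝ × ℝ, c + Complex.polarCoord.symm p = circleMap c p.1 p.2 := by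
      intro p
      rw [circleMap, Complex.polarCoord_symm_apply, Complex.exp_mul_I]
      simp
    simp_rw [h3, smul_eq_mul] at h1
    rw [← h1] at hfin
    have h4 : Measurable fun p : ℝ × ℝ ↦ ENNReal.ofReal p.1 * h (circleMap c p.1 p.2) := by
      refine (ENNReal.measurable_ofReal.comp measurable_fst).mul (hm.comp ?_)
      unfold circleMap
      fun_prop
    rwa [show polarCoord.target = Ioi (0 : ℝ) ×ˢ Ioo (-π) π from rfl, Measure.volume_eq_prod,
      ← Measure.prod_restrict, lintegral_prod _ h4.aemeasurable] at hfin
  have hmθ : ∀ r j, Measurable fun θ ↦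
      (D j).indicator (fun z ↦ ‖deriv (F j) z‖ₑ ^ 2) (circleMap c r θ) := fun r j ↦
    (hmj j).comp (continuous_circleMap c r).measurable
  -- If every circle had energy above `ε / r ^ 2`, integration in polar coordinates would bound the
  -- integral of `ε / r` near zero by a finite area.
  have hlow : ∫⁻ r in Ioo 0 ρ, ENNReal.ofReal (ε * r⁻¹) < ⊤ := by
    refine lt_of_le_of_lt ?_ hpolar
    refine (setLIntegral_mono' measurableSet_Ioo fun r hr ↦ ?_).trans
      (lintegral_mono_set Ioo_subset_Ioi_self)
    have h1 := (hcon r hr).le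
    rw [← lintegral_tsum fun j ↦ (hmθ r j).aemeasurable] at h1
    have hmc : Measurable fun θ ↦ h (circleMap c r θ) :=
      hm.comp (continuous_circleMap c r).measurable
    rw [lintegral_const_mul _ hmc]
    have hr0 : 0 < r := hr.1
    calc ENNReal.ofReal (ε * r⁻¹) = ENNReal.ofReal r⁻¹ * ENNReal.ofReal ε := by
          rw [mul_comm, ENNReal.ofReal_mul (by positivity)]
      _ ≤ ENNReal.ofReal r⁻¹ * (ENNReal.ofReal (r ^ 2) * ∫⁻ θ in Ioo (-π) π,
            h (circleMap c r θ)) := by gcongr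
      _ = _ := by
          rw [← mul_assoc, ← ENNReal.ofReal_mul (by positivity)]
          congr 2
          field_simp
  have hint : IntegrableOn (fun r : ℝ ↦ ε * r⁻¹) (Ioo 0 ρ) := by
    refine ⟨by fun_prop, ?_⟩
    rw [hasFiniteIntegral_iff_ofReal]
    · exact hlow
    · filter_upwards [ae_restrict_mem measurableSet_Ioo] with r hr
      have := hr.1
      show 0 ≤ ε * r⁻¹
      positivity
  have hint2 : IntervalIntegrable (fun r : ℝ ↦ r⁻¹) volume 0 ρ := by
    rw [intervalIntegrable_iff_integrableOn_Ioo_of_le hρ.le]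
    refine (hint.const_mul ε⁻¹).congr (ae_of_all _ fun r ↦ ?_)
    field_simp
  rw [intervalIntegrable_inv_iff] at hint2
  rcases hint2 with h | h
  · exact hρ.ne h
  · exact h left_mem_uIcc

-- The energy controls the length of the image of the circle, as in the Cauchy-Schwarz inequality.
open MeasureTheory Real in
theorem norm_sub_le_of_circle_energy_le {F : ℂ → ℂ} {D : Set ℂ} (hD : IsOpen D)
    (hF : DifferentiableOn ℂ F D) {c : ℂ} {r b : ℝ} (hr : 0 < r) (hb : 0 < b)
    (hsub : Metric.sphere c r ⊆ D)
    (hE : ENNReal.ofReal (r ^ 2) * ∫⁻ θ in Ioo (-π) π,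
      D.indicator (fun z ↦ ‖deriv F z‖ₑ ^ 2) (circleMap c r θ) ≤ ENNReal.ofReal (b ^ 2 / (8 * π)))
    {z w : ℂ} (hz : z ∈ Metric.sphere c r) (hw : w ∈ Metric.sphere c r) :
    ‖F z - F w‖ ≤ b := by
  have hmem : ∀ θ, circleMap c r θ ∈ D := fun θ ↦ hsub (circleMap_mem_sphere c hr.le θ)
  have hFc : ContinuousOn (deriv F) D := (hF.deriv hD).continuousOn
  have hcont : Continuous fun θ ↦ deriv F (circleMap c r θ) :=
    hFc.comp_continuous (continuous_circleMap c r) hmem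
  have hder : ∀ θ, HasDerivAt (fun θ ↦ F (circleMap c r θ))
      (deriv F (circleMap c r θ) * (circleMap 0 r θ * Complex.I)) θ := fun θ ↦
    (hF.differentiableAt (hD.mem_nhds (hmem θ))).hasDerivAt.comp θ (hasDerivAt_circleMap c r θ)
  set v : ℝ → ℝ := fun θ ↦ r * ‖deriv F (circleMap c r θ)‖ with hv
  have hvc : Continuous v := by fun_prop
  have hv0 : ∀ θ, 0 ≤ v θ := fun θ ↦ by positivity
  have hsq : ∫ θ in (-π)..π, v θ ^ 2 ≤ b ^ 2 / (8 * π) := by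
    rw [intervalIntegral.integral_of_le (by linarith [pi_pos]), integral_Ioc_eq_integral_Ioo]
    rw [integral_eq_lintegral_of_nonneg_ae (ae_of_all _ fun θ ↦ by positivity)
      (by fun_prop)]
    refine ENNReal.toReal_le_of_le_ofReal (by positivity) (le_trans (le_of_eq ?_) hE)
    rw [← lintegral_const_mul']
    · refine lintegral_congr fun θ ↦ ?_
      rw [indicator_of_mem (hmem θ), hv, mul_pow, ENNReal.ofReal_mul (by positivity),
        ENNReal.ofReal_pow (norm_nonneg _), ofReal_norm]
    · exact ENNReal.ofReal_ne_top
  have hint : ∫ θ in (-π)..π, v θ ≤ b := by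
    -- With `a = b / (4 * π)`, either `v ≤ a` or `v ≤ v ^ 2 / a`. After integration each term
    -- contributes at most `b / 2`.
    have h1 : ∀ θ, v θ ≤ b / (4 * π) + (4 * π / b) * v θ ^ 2 := by
      intro θ
      by_cases h : v θ ≤ b / (4 * π)
      · have : 0 ≤ (4 * π / b) * v θ ^ 2 := by positivity
        linarith
      · push Not at h
        have h2 : 1 ≤ (4 * π / b) * v θ := by
          rw [div_lt_iff₀ (by positivity)] at h
          rw [div_mul_eq_mul_div, le_div_iff₀ hb]
          linarith
        have : 0 ≤ b / (4 * π) := by positivity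
        nlinarith [hv0 θ]
    calc ∫ θ in (-π)..π, v θ ≤ ∫ θ in (-π)..π, (b / (4 * π) + (4 * π / b) * v θ ^ 2) :=
          intervalIntegral.integral_mono_on (by linarith [pi_pos]) (hvc.intervalIntegrable _ _)
            (Continuous.intervalIntegrable (by fun_prop) _ _) fun θ _ ↦ h1 θ
      _ = (2 * π) * (b / (4 * π)) + (4 * π / b) * ∫ θ in (-π)..π, v θ ^ 2 := by
          rw [intervalIntegral.integral_add (by simp)
            (Continuous.intervalIntegrable (by fun_prop) _ _),
            intervalIntegral.integral_const_mul]
          simp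
          ring
      _ ≤ (2 * π) * (b / (4 * π)) + (4 * π / b) * (b ^ 2 / (8 * π)) := by gcongr
      _ = b := by field_simp; norm_num
  have key : ∀ α ∈ Ioc (-π) π, ∀ β ∈ Ioc (-π) π, α ≤ β →
      ‖F (circleMap c r β) - F (circleMap c r α)‖ ≤ b := by
    intro α hα β hβ hαβ
    rw [← intervalIntegral.integral_eq_sub_of_hasDerivAt (fun θ _ ↦ hder θ)
      (Continuous.intervalIntegrable (by fun_prop) _ _)]
    refine (intervalIntegral.norm_integral_le_integral_norm hαβ).trans (le_trans ?_ hint)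
    have : ∀ θ, ‖deriv F (circleMap c r θ) * (circleMap 0 r θ * Complex.I)‖ = v θ := fun θ ↦ by
      simp [hv, abs_of_pos hr, mul_comm]
    simp_rw [this]
    exact intervalIntegral.integral_mono_interval hα.1.le hαβ hβ.2
      (ae_of_all _ hv0) (hvc.intervalIntegrable _ _)
  have hpar : ∀ z ∈ Metric.sphere c r, ∃ α ∈ Ioc (-π) π, circleMap c r α = z := by
    intro z hz
    refine ⟨(z - c).arg, Complex.arg_mem_Ioc _, ?_⟩
    rw [mem_sphere_iff_norm] at hz
    rw [circleMap, ← hz, Complex.norm_mul_exp_arg_mul_I]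
    ring
  obtain ⟨α, hα, rfl⟩ := hpar z hz
  obtain ⟨β, hβ, rfl⟩ := hpar w hw
  rcases le_total α β with h | h
  · rw [norm_sub_rev]; exact key α hα β hβ h
  · exact key β hβ α hα h

/-! ### Bloch's theorem. -/

/-- A form of Bloch's theorem. -/
theorem norm_deriv_mul_le_of_no_ball {u : ℂ → ℂ} {c : ℂ} {r η : ℝ} (hr : 0 < r)
    (hu : DifferentiableOn ℂ u (Metric.ball c r))
    (hno : ∀ b ∈ Metric.ball c r, ¬ Metric.ball (u b) η ⊆ u '' Metric.ball c r) :
    ‖deriv u c‖ * r ≤ 128 * η := by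
  have hud : DifferentiableOn ℂ (deriv u) (Metric.ball c r) := hu.deriv Metric.isOpen_ball
  have hsub : Metric.closedBall c (r / 2) ⊆ Metric.ball c r :=
    Metric.closedBall_subset_ball (by linarith)
  -- Landau's trick: at a maximum of the weighted derivative, `‖deriv u‖` at most doubles within
  -- half the remaining distance `R`.
  obtain ⟨z₁, hz₁, hmax⟩ := (isCompact_closedBall c (r / 2)).exists_isMaxOn
    (f := fun z ↦ (r / 2 - ‖z - c‖) * ‖deriv u z‖) ⟨c, Metric.mem_closedBall_self (by linarith)⟩
    (ContinuousOn.mul (by fun_prop) (hud.continuousOn.mono hsub).norm)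
  set m := ‖deriv u z₁‖ with hm
  set R := (r / 2 - ‖z₁ - c‖) / 2 with hR
  have hMc : r / 2 * ‖deriv u c‖ ≤ 2 * R * m := by
    have := hmax (Metric.mem_closedBall_self (by linarith) : c ∈ _)
    simp only [mem_ofPred_eq, sub_self, norm_zero, sub_zero] at this
    rw [hR]; linarith
  have hz₁' : ‖z₁ - c‖ ≤ r / 2 := by simpa [dist_eq_norm] using hz₁
  have hR0 : 0 ≤ R := by rw [hR]; linarith
  by_contra! hcon
  have hη : 0 < η := by
    by_contra! h
    refine hno c (Metric.mem_ball_self hr) ?_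
    simp [Metric.ball_eq_empty.2 h]
  have hRm : 32 * η < R * m := by linarith
  have hRpos : 0 < R := lt_of_le_of_ne hR0 fun h ↦ by rw [← h] at hRm; linarith
  have hmpos : 0 < m := lt_of_le_of_ne (norm_nonneg _) fun h ↦ by rw [← h] at hRm; linarith
  have hin : ∀ z ∈ Metric.closedBall z₁ R, ‖z - c‖ ≤ r / 2 - R := by
    intro z hz
    have h1 : ‖z - z₁‖ ≤ R := by simpa [dist_eq_norm] using hz
    have h2 : ‖z - c‖ ≤ ‖z - z₁‖ + ‖z₁ - c‖ := norm_sub_le_norm_sub_add_norm_sub z z₁ c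
    linarith
  have hball : ∀ z ∈ Metric.closedBall z₁ R, z ∈ Metric.ball c r := fun z hz ↦ by
    rw [mem_ball_iff_norm]; linarith [hin z hz]
  have hbd : ∀ z ∈ Metric.closedBall z₁ R, ‖deriv u z‖ ≤ 2 * m := by
    intro z hz
    have h1 := hin z hz
    have h2 := hmax (show z ∈ Metric.closedBall c (r / 2) by
      rw [mem_closedBall_iff_norm]; linarith)
    simp only [mem_ofPred_eq] at h2
    have h3 : R * ‖deriv u z‖ ≤ (r / 2 - ‖z - c‖) * ‖deriv u z‖ := by gcongr; linarith
    have h4 : R * ‖deriv u z‖ ≤ R * (2 * m) := by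
      refine h3.trans (h2.trans (le_of_eq ?_)); rw [hR]; ring
    exact le_of_mul_le_mul_left h4 hRpos
  have hbd2 : ∀ z ∈ Metric.closedBall z₁ (R / 2), ‖deriv (deriv u) z‖ ≤ 2 * m / (R / 2) := by
    intro z hz
    have hss : Metric.closedBall z (R / 2) ⊆ Metric.closedBall z₁ R := by
      refine Metric.closedBall_subset_closedBall' ?_
      have := Metric.mem_closedBall.1 hz
      linarith
    refine Complex.norm_deriv_le_of_forall_mem_sphere_norm_le (by positivity) ?_ ?_
    · refine DifferentiableOn.diffContOnCl ?_
      rw [closure_ball _ (by positivity)]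
      exact hud.mono fun w hw ↦ hball w (hss hw)
    · exact fun w hw ↦ hbd w (hss (Metric.sphere_subset_closedBall hw))
  -- By the Cauchy estimate, `deriv u` varies by at most `4 * m / R * s = m / 2` on this disk. Thus
  -- `u` moves its boundary by at least `m * s / 2`, and the image contains a disk of radius `m * s
  -- / 4 = R * m / 32 > η`.
  set s := R / 8 with hs
  have hspos : 0 < s := by positivity
  have hclose : ∀ z ∈ Metric.closedBall z₁ s, ‖deriv u z - deriv u z₁‖ ≤ m / 2 := by
    intro z hz
    have h1 := (convex_closedBall z₁ (R / 2)).norm_image_sub_le_of_norm_deriv_le (f := deriv u)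
      (fun x hx ↦ hud.differentiableAt (Metric.isOpen_ball.mem_nhds
        (hball x (Metric.closedBall_subset_closedBall (by linarith) hx)))) hbd2
      (Metric.mem_closedBall_self (by positivity))
      (Metric.closedBall_subset_closedBall (by linarith) hz)
    have h2 : ‖z - z₁‖ ≤ R / 8 := by simpa [dist_eq_norm] using hz
    calc _ ≤ _ := h1
      _ ≤ 2 * m / (R / 2) * (R / 8) := by gcongr
      _ = m / 2 := by field_simp; norm_num
  have hdiffz : ∀ z ∈ Metric.closedBall z₁ s, DifferentiableAt ℂ u z := fun x hx ↦
    hu.differentiableAt (Metric.isOpen_ball.mem_nhds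
        (hball x (Metric.closedBall_subset_closedBall (by linarith) hx)))
  have hsph : ∀ z ∈ Metric.sphere z₁ s, m * s / 2 ≤ ‖u z - u z₁‖ := by
    intro z hz
    have h1 := (convex_closedBall z₁ s).norm_image_sub_le_of_norm_deriv_le
      (f := fun z ↦ u z - deriv u z₁ * z) (C := m / 2)
      (fun x hx ↦ (hdiffz x hx).sub (by fun_prop)) (fun x hx ↦ by
        rw [deriv_fun_sub (hdiffz x hx) (by fun_prop), deriv_const_mul_field]
        simpa using hclose x hx)
      (Metric.mem_closedBall_self hspos.le) (Metric.sphere_subset_closedBall hz)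
    have hzs : ‖z - z₁‖ = s := by simpa [dist_eq_norm] using hz
    have h2 : ‖deriv u z₁ * (z - z₁)‖ = m * s := by rw [norm_mul, hzs]
    have h3 : ‖deriv u z₁ * (z - z₁)‖ - ‖u z - u z₁‖ ≤
        ‖(u z - deriv u z₁ * z) - (u z₁ - deriv u z₁ * z₁)‖ := by
      have := norm_sub_norm_le (deriv u z₁ * (z - z₁)) (u z - u z₁)
      rwa [← norm_neg (deriv u z₁ * (z - z₁) - (u z - u z₁)), show
        -(deriv u z₁ * (z - z₁) - (u z - u z₁)) =
          (u z - deriv u z₁ * z) - (u z₁ - deriv u z₁ * z₁) by ring] at this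
    rw [hzs] at h1
    linarith
  have himg := DiffContOnCl.ball_subset_image_closedBall
    (DifferentiableOn.diffContOnCl (by
      rw [closure_ball _ hspos.ne']
      exact fun x hx ↦ (hdiffz x hx).differentiableWithinAt)) hspos hsph
    (by
      have h1 := (hdiffz z₁ (Metric.mem_closedBall_self hspos.le)).hasDerivAt.eventually_ne
        (c := u z₁) (norm_pos_iff.1 hmpos)
      exact (h1.frequently).filter_mono nhdsWithin_le_nhds)
  refine hno z₁ (hball z₁ (Metric.mem_closedBall_self hR0)) ?_
  refine (Metric.ball_subset_ball ?_).trans (himg.trans (image_mono fun x hx ↦ hball x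
    (Metric.closedBall_subset_closedBall (by linarith) hx)))
  rw [hs]
  linarith

/-! ### Iterates of a partial map and contracting disks. -/

/-- The points whose first `n` iterates, starting with the point itself, lie in `W`. -/
def iterDomain (g : ℂ → ℂ) (W : Set ℂ) (n : ℕ) : Set ℂ := {z | ∀ i < n, g^[i] z ∈ W}

theorem mem_iterDomain {g : ℂ → ℂ} {W : Set ℂ} {n : ℕ} {z : ℂ} :
    z ∈ iterDomain g W n ↔ ∀ i < n, g^[i] z ∈ W := Iff.rfl

theorem iterDomain_zero (g : ℂ → ℂ) (W : Set ℂ) : iterDomain g W 0 = univ := by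
  ext; simp [mem_iterDomain]

theorem iterDomain_succ (g : ℂ → ℂ) (W : Set ℂ) (n : ℕ) :
    iterDomain g W (n + 1) = W ∩ g ⁻¹' iterDomain g W n := by
  ext z
  simp only [mem_iterDomain, mem_inter_iff, mem_preimage]
  constructor
  · intro h
    exact ⟨h 0 (by lia), fun i hi ↦ by simpa using h (i + 1) (by lia)⟩
  · rintro ⟨h0, h⟩ i hi
    cases i with
    | zero => exact h0
    | succ i => simpa using h i (by lia)

theorem isOpen_iterDomain {g : ℂ → ℂ} {W : Set ℂ} (hW : IsOpen W) (hg : ContinuousOn g W) (n : ℕ) :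
    IsOpen (iterDomain g W n) := by
  induction n with
  | zero => simp [iterDomain_zero]
  | succ n ih => rw [iterDomain_succ]; exact hg.isOpen_inter_preimage hW ih

theorem differentiableOn_iterate {g : ℂ → ℂ} {W : Set ℂ} (hg : DifferentiableOn ℂ g W) (n : ℕ) :
    DifferentiableOn ℂ g^[n] (iterDomain g W n) := by
  induction n with
  | zero => exact differentiableOn_id
  | succ n ih =>
    rw [iterDomain_succ, Function.iterate_succ]
    exact ih.comp (hg.mono inter_subset_left) fun z hz ↦ hz.2

theorem injOn_iterate {g : ℂ → ℂ} {W : Set ℂ} (hg : InjOn g W) (n : ℕ) :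
    InjOn g^[n] (iterDomain g W n) := by
  induction n with
  | zero => exact injOn_id _
  | succ n ih =>
    rw [iterDomain_succ, Function.iterate_succ]
    exact ih.comp (hg.mono inter_subset_left) fun z hz ↦ hz.2

theorem iterDomain_add {g : ℂ → ℂ} {W : Set ℂ} {m n : ℕ} {z : ℂ} :
    z ∈ iterDomain g W (m + n) ↔ z ∈ iterDomain g W m ∧ g^[m] z ∈ iterDomain g W n := by
  simp only [mem_iterDomain]
  constructor
  · intro h
    refine ⟨fun i hi ↦ h i (by lia), fun i hi ↦ ?_⟩
    rw [← Function.iterate_add_apply]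
    exact h _ (by lia)
  · rintro ⟨h1, h2⟩ i hi
    by_cases him : i < m
    · exact h1 i him
    · have := h2 (i - m) (by lia)
      rwa [← Function.iterate_add_apply, Nat.sub_add_cancel (by lia)] at this

/-- A ball on which all iterates of `g` are defined, do not return and contract. -/
structure IsContractingBall (g : ℂ → ℂ) (W : Set ℂ) (c : ℂ) (r : ℝ) : Prop where
  pos : 0 < r
  iterate_mem : ∀ z ∈ Metric.ball c r, ∀ n, g^[n] z ∈ W
  wandering : ∀ z ∈ Metric.ball c r, ∀ n, 0 < n → g^[n] z ∉ Metric.ball c r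
  contracting : ∀ δ > 0, ∀ᶠ n in atTop, ∀ z ∈ Metric.ball c r, ‖g^[n] z - g^[n] c‖ < δ

-- Disjointness of the images gives a circle of small total energy. Its radius is not known in
-- advance, so `hpt` supplies on every circle a point with orbit deep inside `V`; that point anchors
-- the images of the disk in `V`.
open MeasureTheory in
theorem exists_isContractingBall {g : ℂ → ℂ} {W V : Set ℂ} {c : ℂ} {r₀ ε : ℝ} {j₀ : ℕ}
    (hg : DifferentiableOn ℂ g W) (hinj : InjOn g W) (hV : IsOpen V) (hVW : V ⊆ W)
    (hvol : volume (g '' W) < ⊤) (hr₀ : 0 < r₀) (hε : 0 < ε) (hj₀ : 0 < j₀)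
    (hdom : Metric.ball c r₀ ⊆ iterDomain g W j₀) (hVB : Disjoint V (Metric.ball c r₀))
    (hret : ∀ i, 0 < i → i < j₀ → ∀ z ∈ Metric.ball c r₀, g^[i] z ∉ Metric.ball c r₀)
    (hpt : ∀ r ∈ Ioo 0 r₀, ∃ a ∈ Metric.sphere c r, ∀ n ≥ j₀, Metric.ball (g^[n] a) ε ⊆ V) :
    ∃ r, IsContractingBall g W c r := by
  set B := Metric.ball c r₀ with hB
  set F : ℕ → ℂ → ℂ := fun j ↦ g^[j₀ + j] with hF
  set D : ℕ → Set ℂ := fun j ↦ B ∩ g^[j₀] ⁻¹' iterDomain g V j with hD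
  have hBd : DifferentiableOn ℂ g^[j₀] B := (differentiableOn_iterate hg j₀).mono hdom
  have hDo : ∀ j, IsOpen (D j) := fun j ↦ hBd.continuousOn.isOpen_inter_preimage Metric.isOpen_ball
    (isOpen_iterDomain hV (hg.continuousOn.mono hVW) j)
  have hmono : ∀ j, iterDomain g V j ⊆ iterDomain g W j := fun j z hz i hi ↦ hVW (hz i hi)
  have hDW : ∀ j, D j ⊆ iterDomain g W (j₀ + j) := fun j z hz ↦
    iterDomain_add.2 ⟨hdom hz.1, hmono j hz.2⟩
  have hFd : ∀ j, DifferentiableOn ℂ (F j) (D j) := fun j ↦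
    (differentiableOn_iterate hg _).mono (hDW j)
  have hFi : ∀ j, InjOn (F j) (D j) := fun j ↦ (injOn_iterate hinj _).mono (hDW j)
  -- points of `D j` do not come back
  have hback : ∀ j, ∀ w ∈ D j, ∀ k, 0 < k → k < j₀ + j → g^[k] w ∉ B := by
    intro j w hw k hk hkj
    by_cases h : k < j₀
    · exact hret k hk h w hw.1
    · have h1 : g^[k - j₀] (g^[j₀] w) ∈ V := hw.2 (k - j₀) (by lia)
      rw [← Function.iterate_add_apply, Nat.sub_add_cancel (by lia)] at h1
      exact disjoint_left.1 hVB h1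
  -- Cancelling the common iterate by injectivity would make a point of `D j` return to `B` after `j
  -- - i` steps.
  have hlt : ∀ i j, i < j → Disjoint (F i '' D i) (F j '' D j) := by
    intro i j hij
    rw [disjoint_left]
    rintro _ ⟨z, hz, rfl⟩ ⟨w, hw, hwz⟩
    have hsplit : j₀ + j = (j - i) + (j₀ + i) := by lia
    have h1 := hDW j hw
    rw [hsplit] at h1
    have h2 := (iterDomain_add.1 h1).2
    have h3 : g^[j₀ + i] (g^[j - i] w) = g^[j₀ + i] z := by
      rw [← Function.iterate_add_apply, show j₀ + i + (j - i) = j₀ + j by lia]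
      exact hwz
    have h4 := injOn_iterate hinj _ h2 (hDW i hz) h3
    exact hback j w hw (j - i) (by lia) (by lia) (h4 ▸ hz.1)
  have hdisj : Pairwise fun i j ↦ Disjoint (F i '' D i) (F j '' D j) := by
    intro i j hij
    rcases lt_or_gt_of_ne hij with h | h
    · exact hlt i j h
    · exact (hlt j i h).symm
  have hFS : ∀ j, F j '' D j ⊆ g '' W := by
    rintro j _ ⟨z, hz, rfl⟩
    refine ⟨g^[j₀ + j - 1] z, hDW j hz _ (by lia), ?_⟩
    rw [← Function.iterate_succ_apply' g]
    congr 2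
    lia
  set b := ε / 2 with hb
  have hb0 : 0 < b := by positivity
  obtain ⟨r, hr, hE⟩ := exists_circle_energy_le hDo hFd hFi hdisj hvol hFS c hr₀
    (show 0 < b ^ 2 / (8 * Real.pi) by positivity)
  obtain ⟨a, ha, haV⟩ := hpt r hr
  have hcl : Metric.closedBall c r ⊆ B := Metric.closedBall_subset_ball hr.2
  have hfr : frontier (Metric.ball c r) = Metric.sphere c r := frontier_ball c hr.1.ne'
  -- a bound on the circle propagates to the disk
  have hmax : ∀ j, Metric.closedBall c r ⊆ D j → ∀ β > 0,
      ENNReal.ofReal (r ^ 2) * ∫⁻ θ in Ioo (-Real.pi) Real.pi,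
        (D j).indicator (fun z ↦ ‖deriv (F j) z‖ₑ ^ 2) (circleMap c r θ)
          ≤ ENNReal.ofReal (β ^ 2 / (8 * Real.pi)) →
      ∀ z ∈ Metric.closedBall c r, ‖F j z - F j a‖ ≤ β := by
    intro j hj β hβ hEj z hz
    refine Complex.norm_le_of_forall_mem_frontier_norm_le (U := Metric.ball c r)
      (f := fun z ↦ F j z - F j a) Metric.isBounded_ball ?_ ?_
      (by rwa [closure_ball _ hr.1.ne'])
    · refine DifferentiableOn.diffContOnCl ?_
      rw [closure_ball _ hr.1.ne']
      exact ((hFd j).mono hj).sub_const _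
    · intro w hw
      rw [hfr] at hw
      exact norm_sub_le_of_circle_energy_le (hDo j) (hFd j) hr.1 hβ
        (Metric.sphere_subset_closedBall.trans hj) hEj hw ha
  -- While the disk lies in `D j`, its image has all points within `ε / 2` of the image of the
  -- anchor `a`, hence lies in `V`, which gives one more iterate.
  have hsub : ∀ j, Metric.closedBall c r ⊆ D j := by
    intro j
    induction j with
    | zero => exact fun z hz ↦ ⟨hcl hz, by simp [iterDomain_zero]⟩
    | succ j ih =>
      intro z hz
      refine ⟨hcl hz, iterDomain_add.2 ⟨(ih hz).2, ?_⟩⟩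
      intro i hi
      obtain rfl : i = 0 := by lia
      have h1 := hmax j ih b hb0 ((mul_le_mul_right (ENNReal.le_tsum j) _).trans hE) z hz
      have h2 : F j z ∈ V := haV (j₀ + j) (by lia) (by
        rw [mem_ball_iff_norm]
        exact h1.trans_lt (by rw [hb]; linarith))
      rw [Function.iterate_zero, id, ← Function.iterate_add_apply, add_comm]
      exact h2
  have hEt : Tendsto (fun j ↦ ENNReal.ofReal (r ^ 2) * ∫⁻ θ in Ioo (-Real.pi) Real.pi,
        (D j).indicator (fun z ↦ ‖deriv (F j) z‖ₑ ^ 2) (circleMap c r θ)) atTop (𝓝 0) := by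
    refine ENNReal.tendsto_atTop_zero_of_tsum_ne_top ?_
    rw [ENNReal.tsum_mul_left]
    exact (hE.trans_lt ENNReal.ofReal_lt_top).ne
  refine ⟨r, hr.1, fun z hz n ↦ ?_, fun z hz n hn ↦ ?_, fun δ hδ ↦ ?_⟩
  · exact hDW (n + 1) (hsub _ (Metric.ball_subset_closedBall hz)) n (by lia)
  · exact fun h ↦ hback (n + 1) z (hsub _ (Metric.ball_subset_closedBall hz)) n hn (by lia)
      (hcl (Metric.ball_subset_closedBall h))
  · have hpos : 0 < (δ / 4) ^ 2 / (8 * Real.pi) := by positivity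
    have h1 := hEt.eventually (ge_mem_nhds (ENNReal.ofReal_pos.2 hpos))
    have h2 : ∀ᶠ j in atTop, ∀ z ∈ Metric.ball c r, ‖F j z - F j c‖ < δ := by
      filter_upwards [h1] with j hj z hz
      have h3 := hmax j (hsub j) (δ / 4) (by positivity) hj
      have h4 := h3 z (Metric.ball_subset_closedBall hz)
      have h5 := h3 c (Metric.mem_closedBall_self hr.1.le)
      have h6 := norm_sub_le_norm_sub_add_norm_sub (F j z) (F j a) (F j c)
      rw [norm_sub_rev (F j a)] at h6
      linarith
    obtain ⟨N, hN⟩ := eventually_atTop.1 h2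
    filter_upwards [eventually_ge_atTop (j₀ + N)] with n hn
    obtain ⟨k, rfl⟩ := Nat.exists_eq_add_of_le hn
    rw [add_assoc]
    exact hN (N + k) (by lia)

/-! ### Backward curves and their landing. -/

open MeasureTheory in
/-- A curve `γ : (-∞, T] → W \ K` that is moved by the univalent map `g` towards its end, which
accumulates at `K`. -/
structure IsBackwardCurve (g : ℂ → ℂ) (W K : Set ℂ) (γ : ℝ → ℂ) (T : ℝ) : Prop where
  isCompact : IsCompact K
  nonempty : K.Nonempty
  isOpen : IsOpen W
  subset : K ⊆ W
  differentiableOn : DifferentiableOn ℂ g W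
  injOn : InjOn g W
  volume_lt : volume (g '' W) < ⊤
  continuousOn : ContinuousOn γ (Iic T)
  mem : ∀ t ≤ T, γ t ∈ W
  notMem : ∀ t ≤ T, γ t ∉ K
  map : ∀ t ≤ T, g (γ t) = γ (t - 1)
  tendsto : Tendsto (fun t ↦ Metric.infDist (γ t) K) atBot (𝓝 0)

namespace IsBackwardCurve

variable {g : ℂ → ℂ} {W K : Set ℂ} {γ : ℝ → ℂ} {T : ℝ}

theorem iterate (h : IsBackwardCurve g W K γ T) {t : ℝ} (ht : t ≤ T) (n : ℕ) :
    g^[n] (γ t) = γ (t - n) := by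
  induction n with
  | zero => simp
  | succ n ih =>
    have hn : (0 : ℝ) ≤ n := n.cast_nonneg
    rw [Function.iterate_succ_apply', ih, h.map _ (by linarith)]
    push_cast
    ring_nf

theorem infDist_pos (h : IsBackwardCurve g W K γ T) {t : ℝ} (ht : t ≤ T) :
    0 < Metric.infDist (γ t) K :=
  (h.isCompact.isClosed.notMem_iff_infDist_pos h.nonempty).1 (h.notMem t ht)

theorem tendsto_sub_nat (t : ℝ) : Tendsto (fun n : ℕ ↦ t - n) atTop atBot :=
  tendsto_atBot_add_const_left _ t (tendsto_neg_atTop_atBot.comp tendsto_natCast_atTop_atTop)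

/-- A periodic orbit would keep a constant positive distance to `K` along a sequence of times
tending to `-∞`. -/
theorem ne_of_pos (h : IsBackwardCurve g W K γ T) {t : ℝ} (ht : t ≤ T) {n : ℕ} (hn : 0 < n) :
    γ (t - n) ≠ γ t := by
  intro heq
  have h1 : ∀ k : ℕ, γ (t - (n * k : ℕ)) = γ t := by
    intro k
    have : Function.IsPeriodicPt g n (γ t) := by
      rw [Function.IsPeriodicPt, Function.IsFixedPt, h.iterate ht, heq]
    rw [← h.iterate ht]
    exact this.mul_const k
  have h2 : Tendsto (fun k : ℕ ↦ Metric.infDist (γ (t - (n * k : ℕ))) K) atTop (𝓝 0) :=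
    h.tendsto.comp ((tendsto_sub_nat t).comp (tendsto_id.const_mul_atTop' hn))
  simp_rw [h1] at h2
  exact (h.infDist_pos ht).ne (tendsto_nhds_unique h2 tendsto_const_nhds)

theorem exists_isContractingBall (h : IsBackwardCurve g W K γ T) {t : ℝ} (ht : t ≤ T) :
    ∃ r, IsContractingBall g W (γ t) r := by
  obtain ⟨δ, hδ, hδW⟩ := h.isCompact.exists_thickening_subset_open h.isOpen h.subset
  -- The factor two keeps the `ε`-neighbourhood of `K` disjoint from a ball of radius at most `ε`
  -- about `γ t`.
  set ε := min δ (Metric.infDist (γ t) K / 2) with hε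
  have hε0 : 0 < ε := lt_min hδ (by linarith [h.infDist_pos ht])
  have hεt : 2 * ε ≤ Metric.infDist (γ t) K := by
    linarith [min_le_right δ (Metric.infDist (γ t) K / 2)]
  obtain ⟨S, hS⟩ := eventually_atBot.1 (h.tendsto.eventually (gt_mem_nhds (half_pos hε0)))
  obtain ⟨m, hm⟩ := exists_nat_ge (t - S)
  set j₀ := m + 1 with hj₀
  have hj₀S : ∀ n ≥ j₀, ∀ s ≤ t, s - n ≤ S := by
    intro n hn s hs
    have : (j₀ : ℝ) ≤ n := by exact_mod_cast hn
    rw [hj₀] at this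
    push_cast at this
    linarith
  have hmemdom : γ t ∈ iterDomain g W j₀ := fun i _ ↦ by
    rw [h.iterate ht]
    exact h.mem _ (by linarith [(Nat.cast_nonneg i : (0 : ℝ) ≤ i)])
  have hdomo := isOpen_iterDomain h.isOpen h.differentiableOn.continuousOn j₀
  obtain ⟨r₁, hr₁, hr₁d⟩ := Metric.isOpen_iff.1 hdomo _ hmemdom
  -- Returns before time `j₀` are finitely many conditions, excluded by continuity; later ones are
  -- excluded because the orbit is then in the neighbourhood of `K`.
  have hret : ∀ᶠ r in 𝓝[>] (0 : ℝ), ∀ i ∈ Finset.Ioo 0 j₀, ∀ z ∈ Metric.ball (γ t) r,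
      g^[i] z ∉ Metric.ball (γ t) r := by
    rw [Filter.eventually_all_finset]
    intro i hi
    rw [Finset.mem_Ioo] at hi
    have hne : g^[i] (γ t) ≠ γ t := by rw [h.iterate ht]; exact h.ne_of_pos ht hi.1
    have hc : ContinuousAt g^[i] (γ t) :=
      ((differentiableOn_iterate h.differentiableOn i).continuousOn.mono
        (fun z (hz : z ∈ iterDomain g W j₀) k hk ↦ hz k (hk.trans hi.2))).continuousAt (hdomo.mem_nhds hmemdom)
    set d := dist (g^[i] (γ t)) (γ t) with hd
    have hd0 : 0 < d := dist_pos.2 hne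
    have h1 : ∀ᶠ z in 𝓝 (γ t), d / 2 < dist (g^[i] z) (γ t) :=
      (hc.dist continuousAt_const).eventually (lt_mem_nhds (by linarith))
    obtain ⟨η, hη, hηb⟩ := Metric.eventually_nhds_iff_ball.1 h1
    filter_upwards [Ioo_mem_nhdsGT (show 0 < min η (d / 2) by positivity)] with r hr z hz hgz
    have h2 := hηb z (Metric.ball_subset_ball (hr.2.le.trans (min_le_left _ _)) hz)
    have h3 := hr.2.le.trans (min_le_right _ _)
    rw [Metric.mem_ball] at hgz
    linarith
  obtain ⟨r₀, hr₀ret, hr₀⟩ :=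
    (hret.and (Ioo_mem_nhdsGT (show 0 < min r₁ ε by positivity))).exists
  have hr₀r₁ : r₀ ≤ r₁ := hr₀.2.le.trans (min_le_left _ _)
  have hr₀ε : r₀ ≤ ε := hr₀.2.le.trans (min_le_right _ _)
  have hVW : Metric.thickening ε K ⊆ W :=
    (Metric.thickening_mono (min_le_left _ _) K).trans hδW
  have hlip : ∀ z w, Metric.infDist z K ≤ Metric.infDist w K + dist z w := fun z w ↦
    Metric.infDist_le_infDist_add_dist
  refine _root_.exists_isContractingBall (V := Metric.thickening ε K) (ε := ε / 2) (j₀ := j₀)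
    h.differentiableOn h.injOn Metric.isOpen_thickening hVW h.volume_lt hr₀.1
    (by positivity) (by lia) ((Metric.ball_subset_ball hr₀r₁).trans hr₁d) ?_
    (fun i hi hij ↦ hr₀ret i (Finset.mem_Ioo.2 ⟨hi, hij⟩)) ?_
  · rw [disjoint_left]
    intro z hz hzB
    rw [Metric.mem_thickening_iff_infDist_lt h.nonempty] at hz
    rw [Metric.mem_ball, dist_comm] at hzB
    linarith [hlip (γ t) z]
  · intro r hr
    -- Going back in time, the curve leaves the ball to approach `K`, so it crosses every circle
    -- about `γ t` of radius less than `r₀`.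
    have hSt : min S t ≤ t := min_le_right _ _
    have hcont : ContinuousOn (fun s ↦ dist (γ s) (γ t)) (Icc (min S t) t) :=
      (continuous_id.dist continuous_const).comp_continuousOn
        (h.continuousOn.mono fun s hs ↦ hs.2.trans ht)
    have hbig : r ≤ dist (γ (min S t)) (γ t) := by
      have h1 := hS (min S t) (min_le_left _ _)
      have h2 := hlip (γ t) (γ (min S t))
      rw [dist_comm] at h2
      linarith [hr.2]
    obtain ⟨s, hs, hsr⟩ := intermediate_value_Icc' hSt hcont
      (show r ∈ Icc _ _ from ⟨by simpa using hr.1.le, hbig⟩)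
    refine ⟨γ s, hsr, fun n hn z hz ↦ ?_⟩
    rw [h.iterate (hs.2.trans ht), Metric.mem_ball] at hz
    rw [Metric.mem_thickening_iff_infDist_lt h.nonempty]
    have h1 := hS _ (hj₀S n hn s hs.2)
    linarith [hlip z (γ (s - n))]

theorem eventually_forall_norm_sub_lt (h : IsBackwardCurve g W K γ T) {t : ℝ} (ht : t ≤ T) :
    ∃ O ∈ 𝓝[Iic T] t, ∀ δ > 0, ∀ᶠ n : ℕ in atTop, ∀ s ∈ O, ‖γ (s - n) - γ (t - n)‖ < δ := by
  obtain ⟨r, hr⟩ := h.exists_isContractingBall ht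
  have hO : ∀ᶠ s in 𝓝[Iic T] t, γ s ∈ Metric.ball (γ t) r :=
    (h.continuousOn t ht).eventually (Metric.ball_mem_nhds _ hr.pos)
  refine ⟨_, hO.and self_mem_nhdsWithin, fun δ hδ ↦ ?_⟩
  filter_upwards [hr.contracting δ hδ] with n hn s hs
  rw [← h.iterate ht, ← h.iterate hs.2]
  exact hn _ hs.1

/-- Being asymptotic is an equivalence relation on times that holds locally, and a half-line is
connected. -/
theorem tendsto_sub_of_le (h : IsBackwardCurve g W K γ T) {s t : ℝ} (hs : s ≤ T) (ht : t ≤ T) :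
    Tendsto (fun n : ℕ ↦ γ (s - n) - γ (t - n)) atTop (𝓝 0) := by
  refine isPreconnected_Iic.induction₂
    (fun s t ↦ Tendsto (fun n : ℕ ↦ γ (s - n) - γ (t - n)) atTop (𝓝 0)) (s := Iic T)
    (fun t ht ↦ ?_) (fun x y z _ _ _ hxy hyz ↦ ?_) (fun x y _ _ hxy ↦ ?_) hs ht
  · obtain ⟨O, hO, hOδ⟩ := h.eventually_forall_norm_sub_lt ht
    filter_upwards [hO] with s hs
    rw [Metric.tendsto_atTop']
    intro δ hδ
    obtain ⟨N, hN⟩ := eventually_atTop.1 (hOδ δ hδ)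
    refine ⟨N, fun n hn ↦ ?_⟩
    rw [dist_zero_right, norm_sub_rev]
    exact hN n hn.le s hs
  · simpa using hxy.add hyz
  · simpa using hxy.neg

/-- Compactness of the fundamental interval `[T - 1, T]` makes the asymptotics of `γ (s - 1 - n)`
and `γ (s - n)` uniform in `s`. -/
theorem tendsto_step (h : IsBackwardCurve g W K γ T) :
    Tendsto (fun t ↦ γ (t - 1) - γ t) atBot (𝓝 0) := by
  rw [Metric.tendsto_nhds]
  intro δ hδ
  have key : ∀ᶠ n : ℕ in atTop, ∀ s ∈ Icc (T - 1) T, ‖γ (s - 1 - n) - γ (s - n)‖ < δ := by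
    refine isCompact_Icc.induction_on
      (p := fun S ↦ ∀ᶠ n : ℕ in atTop, ∀ s ∈ S, ‖γ (s - 1 - n) - γ (s - n)‖ < δ)
      (by simp) (fun S S' hSS' hS' ↦ hS'.mono fun n hn s hs ↦ hn s (hSS' hs))
      (fun S S' hS hS' ↦ ?_) (fun t ht ↦ ?_)
    · filter_upwards [hS, hS'] with n hn hn' s hs
      exact hs.elim (hn s) (hn' s)
    · obtain ⟨O, hO, hOδ⟩ := h.eventually_forall_norm_sub_lt ht.2
      refine ⟨O, nhdsWithin_mono _ (fun s hs ↦ hs.2) hO, ?_⟩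
      have h1 := hOδ (δ / 3) (by positivity)
      have h2 := (tendsto_add_atTop_nat 1).eventually h1
      have h3 := (h.tendsto_sub_of_le (show t - 1 ≤ T by linarith [ht.2]) ht.2).norm.eventually
        (gt_mem_nhds (show ‖(0 : ℂ)‖ < δ / 3 by simpa using hδ))
      filter_upwards [h1, h2, h3] with n hn1 hn2 hn3 s hs
      have e1 := hn1 s hs
      have e2 := hn2 s hs
      push_cast at e2
      rw [show s - (n + 1 : ℝ) = s - 1 - n by ring, show t - (n + 1 : ℝ) = t - 1 - n by ring] at e2
      rw [norm_sub_rev] at e1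
      have e3 := norm_add₃_le (a := γ (s - 1 - n) - γ (t - 1 - n))
        (b := γ (t - 1 - n) - γ (t - n)) (c := γ (t - n) - γ (s - n))
      rw [show γ (s - 1 - n) - γ (t - 1 - n) + (γ (t - 1 - n) - γ (t - n))
        + (γ (t - n) - γ (s - n)) = γ (s - 1 - n) - γ (s - n) by ring] at e3
      linarith
  obtain ⟨N, hN⟩ := eventually_atTop.1 key
  -- Each `t` is written as `s - n` with `n = ⌊T - t⌋₊` and `s` in the fundamental interval.
  filter_upwards [eventually_le_atBot (T - N)] with t ht
  have h0 : 0 ≤ T - t := by linarith [(N.cast_nonneg : (0 : ℝ) ≤ N)]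
  have h1 := Nat.floor_le h0
  have h2 := Nat.lt_floor_add_one (T - t)
  have h3 := hN ⌊T - t⌋₊ (Nat.le_floor (by linarith)) (t + ⌊T - t⌋₊)
    ⟨by linarith, by linarith⟩
  rwa [show t + (⌊T - t⌋₊ : ℝ) - 1 - ⌊T - t⌋₊ = t - 1 by ring, add_sub_cancel_right,
    ← dist_zero_right] at h3

theorem mapClusterPt_mem (h : IsBackwardCurve g W K γ T) {p : ℂ} (hp : MapClusterPt p atBot γ) :
    p ∈ K ∧ g p = p := by
  have hF : NeBot (atBot ⊓ comap γ (𝓝 p)) := by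
    rw [inf_comm]
    rw [MapClusterPt, ClusterPt] at hp
    simpa [inf_comm] using neBot_inf_comap_iff_map'.2 hp
  have h1 : Tendsto γ (atBot ⊓ comap γ (𝓝 p)) (𝓝 p) := tendsto_comap.mono_left inf_le_right
  have hpK : p ∈ K := by
    rw [h.isCompact.isClosed.mem_iff_infDist_zero h.nonempty]
    exact tendsto_nhds_unique ((Metric.continuous_infDist_pt K).continuousAt.tendsto.comp h1)
      (h.tendsto.mono_left inf_le_left)
  refine ⟨hpK, ?_⟩
  have hgc : ContinuousAt g p :=
    h.differentiableOn.continuousOn.continuousAt (h.isOpen.mem_nhds (h.subset hpK))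
  have h2 : Tendsto (fun t ↦ γ (t - 1)) (atBot ⊓ comap γ (𝓝 p)) (𝓝 (g p)) := by
    refine (hgc.tendsto.comp h1).congr' ?_
    filter_upwards [mem_inf_of_left (Iic_mem_atBot T)] with t ht
    exact h.map t ht
  exact sub_eq_zero.1 (tendsto_nhds_unique (h2.sub h1) (h.tendsto_step.mono_left inf_le_left))

theorem exists_tendsto (h : IsBackwardCurve g W K γ T) :
    ∃ p ∈ K, g p = p ∧ Tendsto γ atBot (𝓝 p) := by
  have hcpt : IsCompact (Metric.cthickening 1 K) := h.isCompact.cthickening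
  have hev : ∀ᶠ t in atBot, γ t ∈ Metric.cthickening 1 K := by
    filter_upwards [h.tendsto.eventually (gt_mem_nhds one_pos)] with t ht
    exact Metric.thickening_subset_cthickening _ _
      ((Metric.mem_thickening_iff_infDist_lt h.nonempty).2 ht)
  obtain ⟨p, -, hp⟩ := hcpt.exists_mapClusterPt (tendsto_principal.2 hev)
  obtain ⟨hpK, hgp⟩ := h.mapClusterPt_mem hp
  refine ⟨p, hpK, hgp, ?_⟩
  have han : AnalyticAt ℂ g p := h.differentiableOn.analyticAt (h.isOpen.mem_nhds (h.subset hpK))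
  rcases han.eventually_eq_or_eventually_ne analyticAt_id with hid | hne
  · exfalso
    obtain ⟨t, hgt, ht⟩ := ((hp.frequently hid).and_eventually (eventually_le_atBot T)).exists
    refine h.ne_of_pos ht one_pos ?_
    rw [Nat.cast_one, ← h.map t ht]
    exact hgt
  rw [eventually_nhdsWithin_iff, Metric.eventually_nhds_iff_ball] at hne
  obtain ⟨ρ, hρ, hne⟩ := hne
  rw [Metric.tendsto_nhds]
  by_contra! hcon
  obtain ⟨ε, hε, hfar⟩ := hcon
  set d := min ε (ρ / 2) with hd
  have hd0 : 0 < d := by positivity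
  have hnear := hp.frequently (Metric.ball_mem_nhds p hd0)
  -- Without convergence the curve oscillates across a small sphere about `p`, producing a second
  -- fixed point there.
  have hsph : ∃ᶠ t in atBot, γ t ∈ Metric.sphere p d := by
    rw [frequently_atBot]
    intro A
    obtain ⟨a, ha, haf⟩ := frequently_atBot.1 hfar (min A T)
    obtain ⟨b, hb, hbn⟩ := frequently_atBot.1 hnear (min A T)
    have hab : ∀ s ∈ uIcc a b, s ≤ min A T := fun s hs ↦ hs.2.trans (sup_le ha hb)
    have hcont : ContinuousOn (fun s ↦ dist (γ s) p) (uIcc a b) :=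
      (continuous_id.dist continuous_const).comp_continuousOn
        (h.continuousOn.mono fun s hs ↦ (hab s hs).trans (min_le_right _ _))
    obtain ⟨s, hs, hsd⟩ := intermediate_value_uIcc hcont (show d ∈ uIcc _ _ from
      mem_uIcc.2 (Or.inr ⟨(Metric.mem_ball.1 hbn).le, (min_le_left _ _).trans haf⟩))
    exact ⟨s, (hab s hs).trans (min_le_left _ _), hsd⟩
  obtain ⟨q, hq, hqc⟩ := (isCompact_sphere p d).exists_mapClusterPt_of_frequently hsph
  refine hne q ?_ ?_ (h.mapClusterPt_mem hqc).2
  · rw [Metric.mem_ball, Metric.mem_sphere.1 hq]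
    linarith [min_le_right ε (ρ / 2)]
  · exact Metric.ne_of_mem_sphere hq hd0.ne'

end IsBackwardCurve

/-! ### Multiplier at an indifferent landing point. -/

/-- A nonvanishing holomorphic function on a disk has a holomorphic logarithm. -/
theorem exists_differentiableOn_exp_eq {F : ℂ → ℂ} {c : ℂ} {r : ℝ} (hr : 0 < r)
    (hF : DifferentiableOn ℂ F (Metric.ball c r)) (hF0 : ∀ z ∈ Metric.ball c r, F z ≠ 0) :
    ∃ u : ℂ → ℂ, DifferentiableOn ℂ u (Metric.ball c r) ∧
      ∀ z ∈ Metric.ball c r, Complex.exp (u z) = F z := by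
  have hq : DifferentiableOn ℂ (fun z ↦ deriv F z / F z) (Metric.ball c r) :=
    (hF.deriv Metric.isOpen_ball).div hF hF0
  have hc := Metric.mem_ball_self hr (x := c)
  obtain ⟨u, huc, hu⟩ := hq.isExactOn_ball.with_val_at c (Complex.log (F c))
  refine ⟨u, fun z hz ↦ (hu z hz).differentiableAt.differentiableWithinAt, fun z hz ↦ ?_⟩
  have hder : ∀ x ∈ Metric.ball c r, HasDerivAt (fun z ↦ F z * Complex.exp (-u z)) 0 x := by
    intro x hx
    have h1 := (hF.differentiableAt (Metric.isOpen_ball.mem_nhds hx)).hasDerivAt.mul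
      (hu x hx).neg.cexp
    refine h1.congr_deriv ?_
    have := hF0 x hx
    field_simp
    ring
  have hconst : F z * Complex.exp (-u z) = F c * Complex.exp (-u c) := by
    refine (convex_ball c r).is_const_of_fderivWithin_eq_zero (𝕜 := ℂ)
      (f := fun z ↦ F z * Complex.exp (-u z))
      (fun x hx ↦ (hder x hx).differentiableAt.differentiableWithinAt) (fun x hx ↦ ?_) hz hc
    rw [fderivWithin_of_isOpen Metric.isOpen_ball hx]
    ext
    simpa using (hder x hx).deriv
  rw [huc, Complex.exp_neg, Complex.exp_neg, Complex.exp_log (hF0 c hc),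
    mul_inv_cancel₀ (hF0 c hc)] at hconst
  exact (eq_of_mul_inv_eq_one hconst).symm

/-- By compactness two powers of `μ` are close together; their quotient is close to one. -/
theorem exists_pos_norm_pow_sub_one_lt {μ : ℂ} (hμ : ‖μ‖ = 1) {κ : ℝ} (hκ : 0 < κ) :
    ∃ k : ℕ, 0 < k ∧ ‖μ ^ k - 1‖ < κ := by
  obtain ⟨a, -, φ, hφ, hlim⟩ := (isCompact_closedBall (0 : ℂ) 1).tendsto_subseq
    (x := fun n : ℕ ↦ μ ^ n) (fun n ↦ by simp [hμ])
  obtain ⟨N, hN⟩ := Metric.cauchySeq_iff.1 hlim.cauchySeq κ hκ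
  have h1 := hN (N + 1) (by lia) N le_rfl
  have h2 : φ N < φ (N + 1) := hφ (by lia)
  refine ⟨φ (N + 1) - φ N, by lia, ?_⟩
  have h3 : μ ^ φ (N + 1) - μ ^ φ N = μ ^ φ N * (μ ^ (φ (N + 1) - φ N) - 1) := by
    rw [mul_sub, ← pow_add, Nat.add_sub_cancel' h2.le, mul_one]
  simpa [dist_eq_norm, h3, hμ] using h1

namespace IsBackwardCurve

variable {g : ℂ → ℂ} {W K : Set ℂ} {γ : ℝ → ℂ} {T : ℝ}

theorem sub_ne_zero (h : IsBackwardCurve g W K γ T) {p : ℂ} (hp : p ∈ K) {t : ℝ} (ht : t ≤ T)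
    (n : ℕ) : γ (t - n) - p ≠ 0 := fun h0 ↦
  h.notMem (t - n) (by linarith [(n.cast_nonneg : (0 : ℝ) ≤ n)]) (_root_.sub_eq_zero.1 h0 ▸ hp)

/-- At an indifferent fixed point, the logarithm of a high iterate on a contracting ball covers
no large disk. -/
theorem eventually_not_ball_subset (h : IsBackwardCurve g W K γ T) {p : ℂ} (hp : p ∈ K)
    (hgp : g p = p) (hlim : Tendsto γ atBot (𝓝 p)) (hμ : ‖deriv g p‖ = 1) {t r : ℝ} (ht : t ≤ T)
    (hr : IsContractingBall g W (γ t) r) {η : ℝ} (hη : 0 < η) :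
    ∀ᶠ n : ℕ in atTop, ∀ u : ℂ → ℂ,
      (∀ z ∈ Metric.ball (γ t) r, Complex.exp (u z) = g^[n] z - p) →
      ∀ b ∈ Metric.ball (γ t) r, ¬ Metric.ball (u b) η ⊆ u '' Metric.ball (γ t) r := by
  have hlog : ∀ᶠ x in 𝓝 (1 : ℂ), ‖Complex.log x‖ < η ∧ x ≠ 0 := by
    have h1 : ContinuousAt (fun x ↦ ‖Complex.log x‖) 1 :=
      (continuousAt_clog (by simp)).norm
    exact (h1.eventually (gt_mem_nhds (by simpa using hη))).and
      (isOpen_ne.mem_nhds one_ne_zero)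
  obtain ⟨κ, hκ, hκlog⟩ := Metric.eventually_nhds_iff_ball.1 hlog
  obtain ⟨k, hk, hμk⟩ := exists_pos_norm_pow_sub_one_lt hμ hκ
  have hgd : HasDerivAt g (deriv g p) p :=
    (h.differentiableOn.differentiableAt (h.isOpen.mem_nhds (h.subset hp))).hasDerivAt
  have hslope := (hasDerivAt_iff_tendsto_slope.1 (HasDerivAt.iterate _ hgd hgp k)).eventually
    (Metric.isOpen_ball.mem_nhds (show deriv g p ^ k ∈ Metric.ball (1 : ℂ) κ by
      rwa [mem_ball_iff_norm]))
  rw [eventually_nhdsWithin_iff, Metric.eventually_nhds_iff_ball] at hslope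
  obtain ⟨ρ, hρ, hslope⟩ := hslope
  have hgpn : ∀ n, g^[n] p = p := fun n ↦ Function.iterate_fixed hgp n
  have hpB : p ∉ Metric.ball (γ t) r := fun hpB ↦
    hr.wandering p hpB 1 one_pos (by rwa [hgpn])
  have hpt := (hlim.comp (tendsto_sub_nat t)).eventually
    (Metric.ball_mem_nhds p (half_pos hρ))
  filter_upwards [hr.contracting (ρ / 2) (half_pos hρ), hpt] with n hn1 hn2 u hu b hb hsub
  have hdom : ∀ z ∈ Metric.ball (γ t) r, ∀ i, g^[i] z ∈ iterDomain g W n := fun z hz i j _ ↦ by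
    rw [← Function.iterate_add_apply]
    exact hr.iterate_mem z hz _
  have hbp : g^[n] b ≠ p := fun hbp ↦ by
    have hpd : p ∈ iterDomain g W n := fun i _ ↦ by rw [hgpn]; exact h.subset hp
    have := injOn_iterate h.injOn n (hdom b hb 0) hpd (by simpa [hgpn] using hbp)
    exact hpB (this ▸ hb)
  have hbρ : g^[n] b ∈ Metric.ball p ρ := by
    have h1 := hn1 b hb
    rw [h.iterate ht] at h1
    have h2 : ‖γ (t - n) - p‖ < ρ / 2 := by simpa [dist_eq_norm] using hn2
    rw [mem_ball_iff_norm]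
    linarith [norm_sub_le_norm_sub_add_norm_sub (g^[n] b) (γ (t - n)) p]
  have hx := hslope _ hbρ hbp
  set x := slope g^[k] p (g^[n] b) with hxdef
  obtain ⟨hxlog, hx0⟩ := hκlog x hx
  have hxmul : (g^[n] b - p) * x = g^[k] (g^[n] b) - p := by
    have := sub_smul_slope g^[k] p (g^[n] b)
    rwa [hgpn, smul_eq_mul] at this
  -- Adding `log x` to the logarithm amounts to applying `g^[k]`. A large disk would thus contain
  -- the logarithm of `g^[k] (g^[n] b) - p`, forcing `g^[k] b` back into the ball.
  obtain ⟨b', hb', hub'⟩ := hsub (show u b + Complex.log x ∈ Metric.ball (u b) η by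
    simpa [mem_ball_iff_norm] using hxlog)
  have h1 : g^[n] b' = g^[n] (g^[k] b) := by
    have h2 := hu b' hb'
    rw [hub', Complex.exp_add, hu b hb, Complex.exp_log hx0, hxmul, ← Function.iterate_add_apply,
      add_comm, Function.iterate_add_apply] at h2
    exact (sub_left_injective h2).symm
  have h2 := injOn_iterate h.injOn n (hdom b' hb' 0) (hdom b hb k) h1
  exact hr.wandering b hb k hk (h2 ▸ hb')

theorem eventually_tendsto_ratio (h : IsBackwardCurve g W K γ T) {p : ℂ} (hp : p ∈ K)
    (hgp : g p = p) (hlim : Tendsto γ atBot (𝓝 p)) (hμ : ‖deriv g p‖ = 1) {t : ℝ} (ht : t ≤ T) :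
    ∀ᶠ s in 𝓝[Iic T] t, Tendsto (fun n : ℕ ↦ (γ (s - n) - p) / (γ (t - n) - p)) atTop (𝓝 1) := by
  obtain ⟨r, hr⟩ := h.exists_isContractingBall ht
  have hO : ∀ᶠ s in 𝓝[Iic T] t, γ s ∈ Metric.ball (γ t) (r / 2) :=
    (h.continuousOn t ht).eventually (Metric.ball_mem_nhds _ (half_pos hr.pos))
  filter_upwards [hO, self_mem_nhdsWithin] with s hs hsT
  rw [Metric.tendsto_atTop']
  intro δ hδ
  have hexp : ∀ᶠ x in 𝓝 (0 : ℂ), ‖Complex.exp x - 1‖ < δ := by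
    have h1 : ContinuousAt (fun x ↦ ‖Complex.exp x - 1‖) 0 := by fun_prop
    exact h1.eventually (gt_mem_nhds (by simpa using hδ))
  obtain ⟨η, hη, hηexp⟩ := Metric.eventually_nhds_iff_ball.1 hexp
  -- Bloch's bound on disks of radius `r / 2` turns `η / 256` into `‖deriv u‖ ≤ η / r`, so `u`
  -- varies by less than `η` on the half ball.
  obtain ⟨N, hN⟩ := eventually_atTop.1
    (h.eventually_not_ball_subset hp hgp hlim hμ ht hr (show 0 < η / 256 by positivity))
  refine ⟨N, fun n hn ↦ ?_⟩
  have hgpn : ∀ n, g^[n] p = p := fun n ↦ Function.iterate_fixed hgp n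
  have hdom : Metric.ball (γ t) r ⊆ iterDomain g W n := fun z hz i _ ↦ hr.iterate_mem z hz i
  have hne : ∀ z ∈ Metric.ball (γ t) r, g^[n] z - p ≠ 0 := fun z hz h0 ↦ by
    have hpd : p ∈ iterDomain g W n := fun i _ ↦ by rw [hgpn]; exact h.subset hp
    have := injOn_iterate h.injOn n (hdom hz) hpd (by
      rw [hgpn]; exact _root_.sub_eq_zero.1 h0)
    exact hr.wandering z hz 1 one_pos (by rwa [this, hgpn, ← this])
  have hd : DifferentiableOn ℂ (fun z ↦ g^[n] z - p) (Metric.ball (γ t) r) :=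
    ((differentiableOn_iterate h.differentiableOn n).mono hdom).sub_const p
  obtain ⟨u, hud, hu⟩ := exists_differentiableOn_exp_eq hr.pos hd hne
  have hno := hN n hn.le u hu
  have hhalf : ∀ z ∈ Metric.ball (γ t) (r / 2), Metric.ball z (r / 2) ⊆ Metric.ball (γ t) r :=
    fun z hz ↦ Metric.ball_subset_ball' (by linarith [Metric.mem_ball.1 hz])
  have hsubr : Metric.ball (γ t) (r / 2) ⊆ Metric.ball (γ t) r :=
    Metric.ball_subset_ball (by linarith [hr.pos])
  have hbd : ∀ z ∈ Metric.ball (γ t) (r / 2), ‖deriv u z‖ ≤ η / r := by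
    intro z hz
    have h1 := norm_deriv_mul_le_of_no_ball (half_pos hr.pos) (hud.mono (hhalf z hz))
      (η := η / 256)
      fun b hb hsub ↦ hno b (hhalf z hz hb) (hsub.trans (image_mono (hhalf z hz)))
    rw [le_div_iff₀ hr.pos]
    linarith
  have hmv := (convex_ball (γ t) (r / 2)).norm_image_sub_le_of_norm_deriv_le
    (fun x hx ↦ hud.differentiableAt (Metric.isOpen_ball.mem_nhds (hsubr hx))) hbd
    (Metric.mem_ball_self (half_pos hr.pos)) hs
  have hlt : ‖u (γ s) - u (γ t)‖ < η := by
    have h1 : ‖γ s - γ t‖ < r / 2 := by rwa [mem_ball_iff_norm] at hs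
    have hr0 := hr.pos
    calc _ ≤ _ := hmv
      _ ≤ η / r * (r / 2) := by gcongr
      _ < η := by field_simp; norm_num
  have h1 := hηexp (u (γ s) - u (γ t)) (by simpa using hlt)
  rwa [Complex.exp_sub, hu _ (hsubr hs), hu _ (Metric.mem_ball_self hr.pos), h.iterate hsT,
    h.iterate ht, ← dist_eq_norm] at h1

/-- Connectedness spreads the local ratio limits to times `T` and `T - 1`, where the ratio is a
difference quotient of `g` at `p`. -/
theorem deriv_eq_one (h : IsBackwardCurve g W K γ T) {p : ℂ} (hp : p ∈ K)
    (hgp : g p = p) (hlim : Tendsto γ atBot (𝓝 p)) (hμ : ‖deriv g p‖ = 1) : deriv g p = 1 := by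
  have hT : T - 1 ≤ T := by linarith
  have h1 : Tendsto (fun n : ℕ ↦ (γ (T - 1 - n) - p) / (γ (T - n) - p)) atTop (𝓝 1) := by
    refine isPreconnected_Iic.induction₂
      (fun t s ↦ Tendsto (fun n : ℕ ↦ (γ (s - n) - p) / (γ (t - n) - p)) atTop (𝓝 1))
      (s := Iic T) (fun t ht ↦ h.eventually_tendsto_ratio hp hgp hlim hμ ht)
      (fun x y z _ hy _ hxy hyz ↦ ?_) (fun x y _ _ hxy ↦ ?_) (le_refl T) hT
    · have := hyz.mul hxy
      rw [one_mul] at this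
      refine this.congr fun n ↦ ?_
      exact div_mul_div_cancel₀ (h.sub_ne_zero hp hy n)
    · simpa using hxy.inv₀ one_ne_zero
  have hgd : HasDerivAt g (deriv g p) p :=
    (h.differentiableOn.differentiableAt (h.isOpen.mem_nhds (h.subset hp))).hasDerivAt
  have h2 : Tendsto (fun n : ℕ ↦ γ (T - n)) atTop (𝓝[≠] p) :=
    tendsto_nhdsWithin_iff.2 ⟨hlim.comp (tendsto_sub_nat T), Eventually.of_forall fun n ↦
      _root_.sub_ne_zero.1 (h.sub_ne_zero hp le_rfl n)⟩
  refine tendsto_nhds_unique ((hasDerivAt_iff_tendsto_slope.1 hgd).comp h2) (h1.congr fun n ↦ ?_)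
  rw [Function.comp_apply, slope_def_field, hgp,
    h.map _ (by linarith [(n.cast_nonneg : (0 : ℝ) ≤ n)])]
  ring_nf

end IsBackwardCurve

/-! ### The snail lemma. -/

theorem lemma5p2 (K U : Set ℂ) (f : ℂ → ℂ) (hK : IsCompact K) (hKc : IsConnected K)
    (hKU : K ⊆ U) (hf : IsUnivalentOn f U) (hfK : f '' K = K) :
    HasSnailLemmaProperty f U K := by
  intro γ hγc hγU hγf hγK
  obtain ⟨g, hfo, hgd, hgf⟩ := hf.exists_inverse
  have hKfU : K ⊆ f '' U := hfK ▸ image_mono hKU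
  -- A closed neighbourhood is compact, so its image under `g` has finite area.
  obtain ⟨δ, hδ, hδU⟩ := hK.exists_cthickening_subset_open hfo hKfU
  have hWU : Metric.thickening δ K ⊆ f '' U :=
    (Metric.thickening_subset_cthickening δ K).trans hδU
  obtain ⟨A, hA⟩ := eventually_atBot.1 (hγK.eventually (gt_mem_nhds hδ))
  set T := min A 0 with hT
  have hTA : T ≤ A := min_le_left _ _
  have hT0 : T ≤ 0 := min_le_right _ _
  have hcurve : IsBackwardCurve g (Metric.thickening δ K) K γ T :=
    { isCompact := hK
      nonempty := hKc.nonempty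
      isOpen := Metric.isOpen_thickening
      subset := Metric.self_subset_thickening hδ K
      differentiableOn := hgd.mono hWU
      injOn := by
        intro z hz w hw hzw
        obtain ⟨x, hx, rfl⟩ := hWU hz
        obtain ⟨y, hy, rfl⟩ := hWU hw
        rw [hgf x hx, hgf y hy] at hzw
        rw [hzw]
      volume_lt := (MeasureTheory.measure_mono (image_mono
        (Metric.thickening_subset_cthickening δ K))).trans_lt
          (hK.cthickening.image_of_continuousOn (hgd.continuousOn.mono hδU)).measure_lt_top
      continuousOn := hγc.mono (Iic_subset_Iic.2 (by linarith))
      mem := fun t ht ↦ (Metric.mem_thickening_iff_infDist_lt hKc.nonempty).2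
        (hA t (ht.trans hTA))
      notMem := fun t ht ↦ (hγU (show t ≤ 1 by linarith)).2
      map := fun t ht ↦ by
        have h1 := hγf (t - 1) (by linarith)
        rw [sub_add_cancel] at h1
        rw [← h1]
        exact hgf _ (hγU (show t - 1 ≤ 1 by linarith)).1
      tendsto := hγK }
  obtain ⟨p, hp, hgp, hlim⟩ := hcurve.exists_tendsto
  have hpU := hKU hp
  have hfp : f p = p := by
    obtain ⟨w, hw, hwp⟩ := hKfU hp
    have h1 := hgf w hw
    rw [hwp, hgp] at h1
    rwa [← h1] at hwp
  have hfd : HasDerivAt f (deriv f p) p :=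
    (hf.differentiableOn.differentiableAt (hf.isOpen.mem_nhds hpU)).hasDerivAt
  have hgdp : HasDerivAt g (deriv g p) (f p) := by
    rw [hfp]
    exact (hgd.differentiableAt (hfo.mem_nhds (hKfU hp))).hasDerivAt
  have hmul : deriv g p * deriv f p = 1 := by
    refine (hgdp.comp p hfd).unique ((hasDerivAt_id p).congr_of_eventuallyEq ?_)
    filter_upwards [hf.isOpen.mem_nhds hpU] with z hz
    exact hgf z hz
  have hnep : ∀ t ≤ 1, γ t ≠ p := fun t ht h ↦ (hγU ht).2 (h ▸ hp)
  refine ⟨p, hpU, ?_, hlim⟩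
  rcases lt_trichotomy ‖deriv f p‖ 1 with hlt | heq | hgt
  -- Near an attracting point the distance to `p` cannot decrease backwards in time, contradicting
  -- `γ → p`.
  · exfalso
    have h1 := (hasDerivAt_iff_tendsto_slope.1 hfd).norm.eventually (gt_mem_nhds hlt)
    have h2 : Tendsto γ atBot (𝓝[≠] p) := tendsto_nhdsWithin_iff.2 ⟨hlim, by
      filter_upwards [Iic_mem_atBot (1 : ℝ)] with t ht using hnep t ht⟩
    obtain ⟨B, hB⟩ := eventually_atBot.1 (h2.eventually h1)
    set t := min B 0 with ht
    have hstep : ∀ s ≤ t, ‖γ (s + 1) - p‖ ≤ ‖γ s - p‖ := by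
      intro s hs
      have hs0 : s ≤ 0 := hs.trans (min_le_right _ _)
      have h3 := hB s (hs.trans (min_le_left _ _))
      rw [slope_def_field, norm_div, hγf s hs0, hfp,
        div_lt_one (norm_pos_iff.2 (sub_ne_zero.2 (hnep s (by linarith))))] at h3
      exact h3.le
    have hmono : ∀ n : ℕ, ‖γ t - p‖ ≤ ‖γ (t - n) - p‖ := by
      intro n
      induction n with
      | zero => simp
      | succ n ih =>
        have h4 := hstep (t - (n + 1 : ℕ)) (by
          linarith [((n + 1).cast_nonneg : (0 : ℝ) ≤ (n + 1 : ℕ))])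
        rw [show t - ((n + 1 : ℕ) : ℝ) + 1 = t - n by push_cast; ring] at h4
        exact ih.trans h4
    have h5 : Tendsto (fun n : ℕ ↦ ‖γ (t - n) - p‖) atTop (𝓝 ‖p - p‖) :=
      ((hlim.comp (IsBackwardCurve.tendsto_sub_nat t)).sub_const p).norm
    have h6 := ge_of_tendsto' h5 hmono
    rw [sub_self, norm_zero, norm_le_zero_iff, sub_eq_zero] at h6
    exact hnep t (by linarith [min_le_right B 0]) h6
  · right
    have hg1 : ‖deriv g p‖ = 1 := by
      have := congrArg norm hmul
      rwa [norm_mul, heq, mul_one, norm_one] at this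
    have hf1 : deriv f p = 1 := by
      rwa [hcurve.deriv_eq_one hp hgp hlim hg1, one_mul] at hmul
    refine ⟨hfp, ⟨1, one_pos, by rw [hf1, one_pow]⟩, fun m hm hid ↦ ?_⟩
    -- An iterate equal to the identity near `p` would make `γ` periodic at some time.
    have hiter : ∀ (k : ℕ) (s : ℝ), s + k ≤ 1 → f^[k] (γ s) = γ (s + k) := by
      intro k
      induction k with
      | zero => simp
      | succ k ih =>
        intro s hs
        push_cast at hs
        rw [Function.iterate_succ_apply', ih s (by linarith), hγf _ (by linarith)]
        push_cast
        ring_nf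
    obtain ⟨s, hs1, hs2⟩ := ((hlim.eventually hid).and (eventually_le_atBot (T - m))).exists
    refine hcurve.ne_of_pos (t := s + m) (by linarith) hm ?_
    rw [add_sub_cancel_right, ← hiter m s (by linarith)]
    exact hs1.symm
  · exact Or.inl ⟨hfp, hgt⟩
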